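/- Let $d$ be a nonnegative integer and let $A,B$ be symmetric positive definite real $d\times d$ matrices. Let $\eta_1,\dots,\eta_d$ be the eigenvalues, counted with multiplicity, of $B^{-1/2}AB^{-1/2}$, where $B^{-1/2}$ is the inverse of the positive definite square root of $B$, and let $$D(A,B)=\sum_{j=1}^d\bigl(\eta_j-1-\log\eta_j\bigr).$$ (More generally, for positive semidefinite $A$ the same formula defines $D(A,B)\in[0,+\infty]$, with the convention $0-1-\log 0=+\infty$.) Let $X\sim N(0,A)$ and $Y\sim N(0,B)$ be $d$-variate random vectors, with densities $f_X$ and $f_Y$, and let $$\mathrm{KL}_{\mathrm{std}}(X,Y)=\int f_X\log\frac{f_X}{f_Y}$$ be the standard Kullback–Leibler divergence (natural logarithm) of the law of $X$ from the law of $Y$. Then $$D(A,B)=2\,\mathrm{KL}_{\mathrm{std}}(X,Y).$$ That is, $D(A,B)$ coincides with the Kullback–Leibler divergence $\mathrm{KL}(X,Y)$ in the normalization $\mathrm{KL}=2\,\mathrm{KL}_{\mathrm{std}}$, in which the factor $\tfrac12$ of the standard Gaussian formula is absent. -/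

import Mathlib

open MeasureTheory ProbabilityTheory InformationTheory
open scoped MatrixOrder

noncomputable section

namespace ScatterDiscrepancy

/-- The matrix `B^{-1/2}`: for positive definite `B`, the inverse of its positive definite square
root. -/
def invSqrt {d : ℕ} (B : Matrix (Fin d) (Fin d) ℝ) : Matrix (Fin d) (Fin d) ℝ :=
  (CFC.sqrt B)⁻¹

lemma invSqrt_isHermitian {d : ℕ} (B : Matrix (Fin d) (Fin d) ℝ) : (invSqrt B).IsHermitian :=
  (Matrix.nonneg_iff_posSemidef.mp (CFC.sqrt_nonneg B)).isHermitian.inv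

/-- The matrix `C = B^{-1/2} A B^{-1/2}`, the scatter `A` in the coordinates in which `B` is
whitened. -/
def whitened {d : ℕ} (A B : Matrix (Fin d) (Fin d) ℝ) : Matrix (Fin d) (Fin d) ℝ :=
  invSqrt B * A * invSqrt B

lemma whitened_isHermitian {d : ℕ} {A : Matrix (Fin d) (Fin d) ℝ} (hA : A.PosSemidef)
    (B : Matrix (Fin d) (Fin d) ℝ) : (whitened A B).IsHermitian := by
  have h := Matrix.isHermitian_mul_mul_conjTranspose (invSqrt B) hA.isHermitian
  rwa [(invSqrt_isHermitian B).eq] at h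

/-- The function `h(η) = η - 1 - log η` on `η ≥ 0`, with the limit value `h(0) = +∞`. (It is only
ever used at `η ≥ 0`.) -/
def h (η : ℝ) : EReal :=
  if 0 < η then ((η - 1 - Real.log η : ℝ) : EReal) else ⊤

/-- The discrepancy `D(A, B) = ∑_j h(η_j)` of a positive semidefinite matrix `A` relative to a
positive definite matrix `B`, where the `η_j` are the eigenvalues, with multiplicity, of
`B^{-1/2} A B^{-1/2}`. -/
def discrepancy {d : ℕ} (A B : Matrix (Fin d) (Fin d) ℝ) (hA : A.PosSemidef) (_hB : B.PosDef) :
    EReal :=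
  ∑ j : Fin d, h ((whitened_isHermitian hA B).eigenvalues j)

end ScatterDiscrepancy

end

/-! Kullback–Leibler divergence is unchanged by an invertible linear change of variables. Let `U`
diagonalise `C = B^{-1/2} A B^{-1/2}` and put `T = B^{1/2} U`. Then `B = T Tᴴ` and `A = T diag(η)
Tᴴ`, so the two Gaussians are the images under `T` of `N(0, I)` and `N(0, diag η)`. These are
product measures whose log-density ratio is a sum over coordinates; its mean under `N(0, diag η)` is
`∑ (η_j - 1 - log η_j) / 2`. -/

namespace MeasureTheory

variable {α β : Type*} [MeasurableSpace α] [MeasurableSpace β]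

/-- Data processing inequality, applied to `e` and to its inverse. -/
lemma klDiv_map_measurableEquiv (μ ν : Measure α) [IsFiniteMeasure μ] [IsFiniteMeasure ν]
    (e : α ≃ᵐ β) : klDiv (μ.map e) (ν.map e) = klDiv μ ν := by
  refine le_antisymm (klDiv_map_le μ ν e.measurable) ?_
  simpa [Measure.map_map e.symm.measurable e.measurable] using
    klDiv_map_le (μ.map e) (ν.map e) e.symm.measurable

lemma klDiv_withDensity_exp {ν : Measure α} [IsProbabilityMeasure ν] {g : α → ℝ}
    (hg : Measurable g)
    [IsProbabilityMeasure (ν.withDensity fun x ↦ ENNReal.ofReal (Real.exp (g x)))]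
    (hint : Integrable g (ν.withDensity fun x ↦ ENNReal.ofReal (Real.exp (g x)))) :
    klDiv (ν.withDensity fun x ↦ ENNReal.ofReal (Real.exp (g x))) ν =
      ENNReal.ofReal (∫ x, g x ∂ν.withDensity fun x ↦ ENNReal.ofReal (Real.exp (g x))) := by
  have hac : ν.withDensity (fun x ↦ ENNReal.ofReal (Real.exp (g x))) ≪ ν :=
    withDensity_absolutelyContinuous _ _
  have hllr : llr (ν.withDensity fun x ↦ ENNReal.ofReal (Real.exp (g x))) ν
      =ᵐ[ν.withDensity fun x ↦ ENNReal.ofReal (Real.exp (g x))] g := by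
    filter_upwards [hac.ae_le (Measure.rnDeriv_withDensity ν
      (f := fun x ↦ ENNReal.ofReal (Real.exp (g x))) (by fun_prop))] with x hx
    simp only [llr_def]
    rw [hx, ENNReal.toReal_ofReal (Real.exp_nonneg _), Real.log_exp]
  rw [klDiv_of_ac_of_integrable hac ((integrable_congr hllr).2 hint), integral_congr_ae hllr]
  simp

/-- It suffices to compare on boxes. There the integrand is a product of functions of single
coordinates, which are independent under the product measure. -/
lemma pi_withDensity {ι : Type*} [Fintype ι] {X : ι → Type*} [∀ i, MeasurableSpace (X i)]
    (ν : ∀ i, Measure (X i)) [∀ i, IsProbabilityMeasure (ν i)] {f : ∀ i, X i → ENNReal}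
    (hf : ∀ i, Measurable (f i)) [∀ i, SigmaFinite ((ν i).withDensity (f i))] :
    Measure.pi (fun i ↦ (ν i).withDensity (f i)) =
      (Measure.pi ν).withDensity fun x ↦ ∏ i, f i (x i) := by
  classical
  refine Measure.pi_eq fun s hs ↦ ?_
  have hind : iIndepFun (fun i (x : ∀ i, X i) ↦ (s i).indicator (f i) (x i)) (Measure.pi ν) :=
    iIndepFun_pi fun i ↦ ((hf i).indicator (hs i)).aemeasurable
  have hprod (x : ∀ i, X i) : (Set.univ.pi s).indicator (fun x ↦ ∏ i, f i (x i)) x =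
      ∏ i, (s i).indicator (f i) (x i) := by
    by_cases hx : x ∈ Set.univ.pi s
    · rw [Set.indicator_of_mem hx]
      exact Finset.prod_congr rfl fun i _ ↦ (Set.indicator_of_mem (hx i trivial) _).symm
    · rw [Set.indicator_of_notMem hx]
      obtain ⟨i, hi⟩ : ∃ i, x i ∉ s i := by simpa using hx
      exact (Finset.prod_eq_zero (Finset.mem_univ i) (Set.indicator_of_notMem hi _)).symm
  rw [withDensity_apply _ (MeasurableSet.univ_pi hs), ← lintegral_indicator (.univ_pi hs)]
  simp_rw [hprod]
  rw [lintegral_prod_eq_prod_lintegral_of_indepFun Finset.univ _ hind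
    fun i ↦ ((hf i).indicator (hs i)).comp (measurable_pi_apply i)]
  refine Finset.prod_congr rfl fun i _ ↦ ?_
  rw [(measurePreserving_eval ν i).lintegral_comp ((hf i).indicator (hs i)),
    lintegral_indicator (hs i), withDensity_apply _ (hs i)]

lemma charFun_map_continuousLinearMap {E F : Type*} [NormedAddCommGroup E] [InnerProductSpace ℝ E]
    [CompleteSpace E] [MeasurableSpace E] [BorelSpace E] [NormedAddCommGroup F]
    [InnerProductSpace ℝ F] [CompleteSpace F] [MeasurableSpace F] [BorelSpace F]
    [SecondCountableTopology F]
    (μ : Measure E) (L : E →L[ℝ] F) (t : F) :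
    charFun (μ.map L) t = charFun μ (L.adjoint t) := by
  rw [charFun_apply, charFun_apply, integral_map (by fun_prop)
    (Measurable.aestronglyMeasurable (by fun_prop))]
  simp_rw [ContinuousLinearMap.adjoint_inner_right]

end MeasureTheory

namespace ProbabilityTheory

/-- The exponent is the difference of the two log-densities; `log v / 2` comes from the normalising
constants. -/
lemma gaussianReal_eq_withDensity_exp {v : NNReal} (hv : v ≠ 0) :
    gaussianReal 0 v = (gaussianReal 0 1).withDensity fun x ↦
      ENNReal.ofReal (Real.exp (x ^ 2 / 2 - x ^ 2 / (2 * v) - Real.log v / 2)) := by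
  have hv' : (0 : ℝ) < v := by positivity
  rw [gaussianReal_of_var_ne_zero _ hv, gaussianReal_of_var_ne_zero _ one_ne_zero,
    ← withDensity_mul _ (measurable_gaussianPDF 0 1) (by fun_prop)]
  congr 1
  ext x
  rw [Pi.mul_apply, gaussianPDF, gaussianPDF, ← ENNReal.ofReal_mul (gaussianPDFReal_nonneg _ _ _)]
  congr 1
  have hsqrt : Real.exp (-(Real.log v / 2)) = (√(v : ℝ))⁻¹ := by
    rw [Real.exp_neg, ← Real.log_sqrt hv'.le, Real.exp_log (Real.sqrt_pos.2 hv')]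
  have hexp : -(x - 0) ^ 2 / (2 * ((1 : NNReal) : ℝ)) +
      (x ^ 2 / 2 - x ^ 2 / (2 * v) - Real.log v / 2) =
      -(Real.log v / 2) + -(x - 0) ^ 2 / (2 * v) := by
    push_cast; ring
  rw [gaussianPDFReal, gaussianPDFReal, mul_assoc _ (Real.exp _), ← Real.exp_add, hexp,
    Real.exp_add, hsqrt, Real.sqrt_mul (by positivity)]
  simp
  ring_nf

lemma integrable_sq_gaussianReal (v : NNReal) :
    Integrable (fun x ↦ x ^ 2) (gaussianReal 0 v) :=
  (memLp_id_gaussianReal (μ := 0) (v := v) 2).integrable_sq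

lemma integral_sq_gaussianReal (v : NNReal) : ∫ x, x ^ 2 ∂gaussianReal 0 v = v := by
  rw [← variance_fun_id_gaussianReal (μ := 0), variance_of_integral_eq_zero (by fun_prop) (by simp)]

lemma klDiv_pi_gaussianReal {ι : Type*} [Fintype ι] (v : ι → NNReal) (hv : ∀ i, v i ≠ 0) :
    klDiv (Measure.pi fun i ↦ gaussianReal 0 (v i)) (Measure.pi fun _ : ι ↦ gaussianReal 0 1) =
      ENNReal.ofReal (∑ i, ((v i : ℝ) - 1 - Real.log (v i)) / 2) := by
  set g : ι → ℝ → ℝ := fun i x ↦ x ^ 2 / 2 - x ^ 2 / (2 * v i) - Real.log (v i) / 2 with hg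
  have hgm (i : ι) : Measurable (g i) := by fun_prop
  have hgi (i : ι) : Integrable (g i) (gaussianReal 0 (v i)) := by
    have := integrable_sq_gaussianReal (v i)
    exact ((this.div_const _).sub (this.div_const _)).sub (integrable_const _)
  have hpi : Measure.pi (fun i ↦ gaussianReal 0 (v i)) =
      (Measure.pi fun _ : ι ↦ gaussianReal 0 1).withDensity
        fun x ↦ ENNReal.ofReal (Real.exp (∑ i, g i (x i))) := by
    have hs (i : ι) : SigmaFinite ((gaussianReal 0 1).withDensity
        fun x ↦ ENNReal.ofReal (Real.exp (g i x))) := by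
      rw [← gaussianReal_eq_withDensity_exp (hv i)]; infer_instance
    rw [show (fun i ↦ gaussianReal 0 (v i)) = fun i ↦ (gaussianReal 0 1).withDensity
      fun x ↦ ENNReal.ofReal (Real.exp (g i x)) from
        funext fun i ↦ gaussianReal_eq_withDensity_exp (hv i),
      pi_withDensity _ fun i ↦ by fun_prop]
    congr 1
    ext x
    rw [Real.exp_sum, ENNReal.ofReal_prod_of_nonneg fun i _ ↦ Real.exp_nonneg _]
  have hint (i : ι) : Integrable (fun x : ι → ℝ ↦ g i (x i))
      (Measure.pi fun i ↦ gaussianReal 0 (v i)) :=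
    ((measurePreserving_eval (fun i ↦ gaussianReal 0 (v i)) i).integrable_comp
      (hgm i).aestronglyMeasurable).2 (hgi i)
  have hsum := integrable_finsetSum Finset.univ fun i _ ↦ hint i
  have : IsProbabilityMeasure ((Measure.pi fun _ : ι ↦ gaussianReal 0 1).withDensity
      fun x ↦ ENNReal.ofReal (Real.exp (∑ i, g i (x i)))) := hpi ▸ inferInstance
  have key := klDiv_withDensity_exp (ν := Measure.pi fun _ : ι ↦ gaussianReal 0 1)
    (g := fun x ↦ ∑ i, g i (x i)) (by fun_prop) (hpi ▸ hsum)
  rw [← hpi] at key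
  rw [key, integral_finsetSum _ fun i _ ↦ hint i]
  congr 1
  refine Finset.sum_congr rfl fun i _ ↦ ?_
  have hvi : (v i : ℝ) ≠ 0 := by exact_mod_cast hv i
  have hsq := integrable_sq_gaussianReal (v i)
  calc ∫ x : ι → ℝ, g i (x i) ∂Measure.pi (fun i ↦ gaussianReal 0 (v i))
    _ = ∫ x, g i x ∂gaussianReal 0 (v i) := by
      rw [← (measurePreserving_eval (fun i ↦ gaussianReal 0 (v i)) i).map_eq,
        integral_map (measurable_pi_apply i).aemeasurable (hgm i).aestronglyMeasurable]
    _ = ((v i : ℝ) - 1 - Real.log (v i)) / 2 := by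
      simp only [hg]
      rw [integral_sub (by exact (hsq.div_const _).sub (hsq.div_const _)) (integrable_const _),
        integral_sub (hsq.div_const _) (hsq.div_const _), integral_div, integral_div,
        integral_sq_gaussianReal]
      simp
      field_simp

section multivariateGaussian

open Matrix

variable {ι : Type*} [DecidableEq ι]

lemma posSemidef_diagonal_coe (v : ι → NNReal) : (diagonal fun i ↦ (v i : ℝ)).PosSemidef :=
  PosSemidef.diagonal fun i ↦ (v i).coe_nonneg

variable [Fintype ι]

/-- Characteristic functions avoid densities, so `D` and `M` may be singular. -/
lemma multivariateGaussian_map_toEuclideanCLM {D : Matrix ι ι ℝ} (hD : D.PosSemidef)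
    (M : Matrix ι ι ℝ) :
    (multivariateGaussian 0 D).map (toEuclideanCLM (𝕜 := ℝ) M) =
      multivariateGaussian 0 (M * D * Mᴴ) := by
  refine Measure.ext_of_charFun (funext fun t ↦ ?_)
  rw [charFun_map_continuousLinearMap, charFun_multivariateGaussian hD,
    charFun_multivariateGaussian (hD.mul_mul_conjTranspose_same M),
    ← ContinuousLinearMap.star_eq_adjoint, ← map_star, star_eq_conjTranspose]
  have hdot : (Mᴴ *ᵥ t.ofLp) ⬝ᵥ D *ᵥ Mᴴ *ᵥ t.ofLp = t.ofLp ⬝ᵥ (M * D * Mᴴ) *ᵥ t.ofLp := by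
    rw [← mulVec_mulVec, ← mulVec_mulVec, dotProduct_mulVec t.ofLp M, conjTranspose_eq_transpose_of_trivial,
      ← mulVec_transpose]
  rw [ofLp_toEuclideanCLM, hdot]
  simp

lemma multivariateGaussian_diagonal (v : ι → NNReal) :
    multivariateGaussian 0 (diagonal fun i ↦ (v i : ℝ)) =
      (Measure.pi fun i ↦ gaussianReal 0 (v i)).map (WithLp.toLp 2) := by
  refine Measure.ext_of_charFun (funext fun t ↦ ?_)
  rw [charFun_pi, charFun_multivariateGaussian (posSemidef_diagonal_coe v)]
  simp_rw [charFun_gaussianReal, ← Complex.exp_sum]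
  congr 1
  simp only [dotProduct, mulVec_diagonal, inner_zero_right, Complex.ofReal_sum, Complex.ofReal_mul,
    Complex.ofReal_zero, mul_zero, zero_mul, zero_sub, Finset.sum_neg_distrib, Finset.sum_div]
  refine congrArg _ (Finset.sum_congr rfl fun i _ ↦ ?_)
  ring

lemma klDiv_multivariateGaussian_diagonal (v : ι → NNReal) (hv : ∀ i, v i ≠ 0) {T : Matrix ι ι ℝ}
    (hT : IsUnit T) :
    klDiv (multivariateGaussian 0 (T * diagonal (fun i ↦ (v i : ℝ)) * Tᴴ))
      (multivariateGaussian 0 (T * Tᴴ)) =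
      ENNReal.ofReal (∑ i, ((v i : ℝ) - 1 - Real.log (v i)) / 2) := by
  -- The identity is written as a diagonal matrix so that both measures reduce to products by the
  -- same lemma.
  have hone : multivariateGaussian 0 (T * Tᴴ) = (multivariateGaussian 0
      (diagonal fun _ ↦ ((1 : NNReal) : ℝ))).map (toEuclideanCLM (𝕜 := ℝ) T) := by
    rw [multivariateGaussian_map_toEuclideanCLM (posSemidef_diagonal_coe fun _ ↦ 1)]
    simp
  obtain ⟨u, hu⟩ := hT.map (toEuclideanCLM (n := ι) (𝕜 := ℝ))
  let e := (ContinuousLinearEquiv.ofUnit u).toHomeomorph.toMeasurableEquiv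
  have he : ⇑(toEuclideanCLM (𝕜 := ℝ) T) = e := by rw [← hu]; rfl
  rw [hone, ← multivariateGaussian_map_toEuclideanCLM (posSemidef_diagonal_coe v), he,
    klDiv_map_measurableEquiv, multivariateGaussian_diagonal, multivariateGaussian_diagonal]
  exact (klDiv_map_measurableEquiv _ _ (MeasurableEquiv.toLp 2 (ι → ℝ))).trans
    (klDiv_pi_gaussianReal v hv)

end multivariateGaussian

end ProbabilityTheory

namespace ScatterDiscrepancy

open Matrix

variable {d : ℕ}

lemma coe_sum_ereal {ι : Type*} (s : Finset ι) (f : ι → ℝ) :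
    ((∑ i ∈ s, f i : ℝ) : EReal) = ∑ i ∈ s, (f i : EReal) :=
  map_sum (⟨⟨Real.toEReal, EReal.coe_zero⟩, EReal.coe_add⟩ : ℝ →+ EReal) f s

lemma isUnit_sqrt {B : Matrix (Fin d) (Fin d) ℝ} (hB : B.PosDef) : IsUnit (CFC.sqrt B) :=
  (CFC.isUnit_sqrt_iff B hB.posSemidef.nonneg).2 hB.isUnit

lemma sqrt_mul_whitened_mul_sqrt (A : Matrix (Fin d) (Fin d) ℝ) {B : Matrix (Fin d) (Fin d) ℝ}
    (hB : B.PosDef) : CFC.sqrt B * whitened A B * CFC.sqrt B = A := by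
  have hdet := (isUnit_iff_isUnit_det _).1 (isUnit_sqrt hB)
  simp only [whitened, invSqrt, Matrix.mul_assoc]
  rw [nonsing_inv_mul _ hdet, Matrix.mul_one, mul_nonsing_inv_cancel_left _ _ hdet]

lemma whitened_posDef {A B : Matrix (Fin d) (Fin d) ℝ} (hA : A.PosDef) (hB : B.PosDef) :
    (whitened A B).PosDef := by
  have hu : IsUnit (invSqrt B) := (isUnit_nonsing_inv_iff).2 (isUnit_sqrt hB)
  have key := hA.mul_mul_conjTranspose_same (vecMul_injective_of_isUnit hu)
  rwa [(invSqrt_isHermitian B).eq] at key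

/-- The discrepancy is twice the Kullback-Leibler divergence between the centered Gaussian measures
with the given covariance matrices. -/
theorem discrepancy_eq_two_mul_klDiv {A B : Matrix (Fin d) (Fin d) ℝ} (hA : A.PosDef)
    (hB : B.PosDef) :
    discrepancy A B hA.posSemidef hB =
      ((2 * klDiv (multivariateGaussian 0 A) (multivariateGaussian 0 B) : ENNReal) : EReal) := by
  have hC := whitened_isHermitian hA.posSemidef B
  have hpos (j : Fin d) : 0 < hC.eigenvalues j :=
    (whitened_posDef hA hB).eigenvalues_pos j
  set v : Fin d → NNReal := fun j ↦ ⟨hC.eigenvalues j, (hpos j).le⟩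
  have hv (j : Fin d) : v j ≠ 0 := by
    rw [← NNReal.coe_ne_zero]
    exact (hpos j).ne'
  set R : Matrix (Fin d) (Fin d) ℝ := CFC.sqrt B with hR
  set U : Matrix (Fin d) (Fin d) ℝ := ↑hC.eigenvectorUnitary with hU
  have hUU : U * Uᴴ = 1 := Unitary.coe_mul_star_self hC.eigenvectorUnitary
  have hRh : Rᴴ = R := (nonneg_iff_posSemidef.mp (CFC.sqrt_nonneg B)).isHermitian.eq
  have hspec : whitened A B = U * diagonal (fun j ↦ (v j : ℝ)) * Uᴴ := by
    conv_lhs => rw [hC.spectral_theorem]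
    rfl
  have hAT : A = R * U * diagonal (fun j ↦ (v j : ℝ)) * (R * U)ᴴ := by
    conv_lhs => rw [← sqrt_mul_whitened_mul_sqrt A hB, hspec]
    simp only [conjTranspose_mul, hRh, Matrix.mul_assoc, ← hR]
  have hBT : B = R * U * (R * U)ᴴ := by
    rw [conjTranspose_mul, hRh, Matrix.mul_assoc, ← Matrix.mul_assoc U, hUU, Matrix.one_mul, hR,
      CFC.sqrt_mul_sqrt_self B hB.posSemidef.nonneg]
  have hT : IsUnit (R * U) :=
    (isUnit_sqrt hB).mul (IsUnit.of_mul_eq_one _ hUU)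
  have hkl : klDiv (multivariateGaussian 0 A) (multivariateGaussian 0 B) =
      ENNReal.ofReal (∑ j, ((v j : ℝ) - 1 - Real.log (v j)) / 2) := by
    rw [← klDiv_multivariateGaussian_diagonal v hv hT, ← hAT, ← hBT]
  -- `ENNReal.ofReal` truncates negative values, so `log η ≤ η - 1` is needed to recover the real
  -- sum.
  have hnonneg : 0 ≤ ∑ j, ((v j : ℝ) - 1 - Real.log (v j)) :=
    Finset.sum_nonneg fun j _ ↦ sub_nonneg.2 (Real.log_le_sub_one_of_pos (hpos j))
  have htwo : 2 * klDiv (multivariateGaussian 0 A) (multivariateGaussian 0 B) =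
      ENNReal.ofReal (∑ j, ((v j : ℝ) - 1 - Real.log (v j))) := by
    rw [hkl, ← ENNReal.ofReal_ofNat 2, ← ENNReal.ofReal_mul zero_le_two, ← Finset.sum_div]
    congr 1
    ring
  rw [htwo, EReal.coe_ennreal_ofReal, max_eq_left hnonneg, coe_sum_ereal, discrepancy]
  refine Finset.sum_congr rfl fun j _ ↦ ?_
  rw [h, if_pos (hpos j)]
  rfl

end ScatterDiscrepancy

theorem proposition4 {d : ℕ} (A B : Matrix (Fin d) (Fin d) ℝ) (hA : A.PosDef) (hB : B.PosDef)
    {Ω Ω' : Type*} [MeasurableSpace Ω] [MeasurableSpace Ω'] (P : Measure Ω) (P' : Measure Ω')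
    (X : Ω → EuclideanSpace ℝ (Fin d)) (Y : Ω' → EuclideanSpace ℝ (Fin d))
    (hX : HasLaw X (multivariateGaussian 0 A) P) (hY : HasLaw Y (multivariateGaussian 0 B) P') :
    ScatterDiscrepancy.discrepancy A B hA.posSemidef hB =
      ((2 * klDiv (P.map X) (P'.map Y) : ENNReal) : EReal) := by
  rw [hX.map_eq, hY.map_eq]
  exact ScatterDiscrepancy.discrepancy_eq_two_mul_klDiv hA hB
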